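/- Let $d\ge 2$ be an integer, $\mathbb T^d=\mathbb R^d/\mathbb Z^d$, $\alpha>1/2$, and let $p$ satisfy $$\frac{d}{2\alpha-1}<p\le\infty\ \text{ if } \tfrac12<\alpha\le\tfrac{d+2}{4},\qquad 2\le p\le\infty\ \text{ if } \alpha>\tfrac{d+2}{4}.$$ Then for every (weakly) divergence-free $u_{\mathrm{in}}\in L^p(\mathbb T^d;\mathbb R^d)$ and every $T\in(0,\infty)$ there is at most one $u\in C([0,T];L^p(\mathbb T^d;\mathbb R^d))$ that is a mild solution, with initial data $u_{\mathrm{in}}$, of the fractional Navier–Stokes equations $$\partial_t u+\operatorname{div}(u\otimes u)+(-\Delta)^\alpha u+\nabla\pi=0,\qquad \operatorname{div}u=0,\qquad u(0)=u_{\mathrm{in}},$$ that is, if $u$ and $v$ are two such solutions, then $u(t)=v(t)$ in $L^p(\mathbb T^d;\mathbb R^d)$ for every $t\in[0,T]$. Here $u\in C([0,T];L^p)$ is called a mild solution with initial data $u_{\mathrm{in}}$ if $$u(t)=e^{-t(-\Delta)^\alpha}u_{\mathrm{in}}-\int_0^t e^{-(t-s)(-\Delta)^\alpha}\,\mathbb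 P\operatorname{div}(u\otimes u)(s)\,ds\qquad\text{in }\mathcal D'((0,T)\times\mathbb T^d),$$ where $(u\otimes u)_{ij}=u_iu_j$ is the pointwise product (an integrable function of $x$ for each time, since $p\ge 2$ in all cases), $(\operatorname{div}A)_i=\sum_j\partial_jA_{ij}$, and $e^{-t(-\Delta)^\alpha}$ and the Leray projection $\mathbb P$ are the Fourier multipliers on distributions on $\mathbb T^d$ with symbols $e^{-t(2\pi|m|)^{2\alpha}}$ and $\left(\delta_{ij}-m_im_j/|m|^2\right)_{i,j}$, $m\in\mathbb Z^d$ (the latter being the identity at $m=0$). -/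

import Mathlib

open MeasureTheory Set
open scoped ENNReal

noncomputable section

namespace FracNS

/-- The torus `𝕋ᵈ = ℝᵈ / ℤᵈ`. -/
abbrev Torus (d : ℕ) : Type := UnitAddTorus (Fin d)

/-- Lebesgue measure on `𝕋ᵈ` (total mass one): the product of the normalised Haar measures of the
circles. Mathlib uses this same measure in the definition of `UnitAddTorus.mFourierCoeff`. -/
abbrev torusMeasure (d : ℕ) : Measure (Torus d) :=
  Measure.pi fun _ => AddCircle.haarAddCircle

/-- `ℝᵈ` with the Euclidean norm, the space of values of the velocity fields. -/
abbrev Vec (d : ℕ) : Type := EuclideanSpace ℝ (Fin d)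

/-- The space `L^p(𝕋ᵈ)` of vector fields with values in `ℝᵈ`, with its norm. -/
abbrev LpField (d : ℕ) (p : ℝ≥0∞) : Type := Lp (Vec d) p (torusMeasure d)

/-- The projection `ℝᵈ → 𝕋ᵈ`. -/
def toTorus {d : ℕ} (y : Fin d → ℝ) : Torus d := fun i => (y i : UnitAddCircle)

/-- `ψ ∈ C^∞(𝕋ᵈ)`, complex valued: the periodic lift of `ψ` to `ℝᵈ` is smooth. -/
def IsSmooth {d : ℕ} (ψ : Torus d → ℂ) : Prop :=
  ContDiff ℝ (⊤ : ℕ∞) (fun y : Fin d → ℝ => ψ (toTorus y))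

/-- `φ ∈ C_c^∞((0,T) × 𝕋ᵈ)`, complex valued. -/
def IsTestFunction {d : ℕ} (T : ℝ) (φ : ℝ → Torus d → ℂ) : Prop :=
  ContDiff ℝ (⊤ : ℕ∞) (fun z : ℝ × (Fin d → ℝ) => φ z.1 (toTorus z.2)) ∧
    ∃ a b : ℝ, 0 < a ∧ b < T ∧ ∀ t, t ∉ Icc a b → ∀ x, φ t x = 0

/-- The partial derivative `∂ᵢ ψ` at a point of the torus. -/
def partialDeriv {d : ℕ} (i : Fin d) (ψ : Torus d → ℂ) (x : Torus d) : ℂ :=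
  deriv (fun h : ℝ => ψ (x + toTorus (Pi.single i h))) 0

/-- An integrable vector field `f` is (weakly) divergence free: `∫ f · ∇ψ = 0` for all
`ψ ∈ C^∞(𝕋ᵈ)`. -/
def IsDivFree {d : ℕ} (f : Torus d → Vec d) : Prop :=
  ∀ ψ : Torus d → ℂ, IsSmooth ψ →
    ∫ x, ∑ i, ((f x i : ℝ) : ℂ) * partialDeriv i ψ x ∂torusMeasure d = 0

/-- The Euclidean length `|m|` of a frequency `m ∈ ℤᵈ`. -/
def freqNorm {d : ℕ} (m : Fin d → ℤ) : ℝ := Real.sqrt (∑ i, (m i : ℝ) ^ 2)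

/-- The symbol `exp(-t (2π|m|)^{2α})` of the operator `e^{-t(-Δ)^α}`. -/
def heatSymbol {d : ℕ} (α t : ℝ) (m : Fin d → ℤ) : ℝ :=
  Real.exp (-t * (2 * Real.pi * freqNorm m) ^ (2 * α))

/-- The symbol `δᵢⱼ - mᵢ mⱼ / |m|²` of the Leray projection `ℙ`. At `m = 0` the quotient is `0 / 0 = 0`
in Lean, so the symbol is the identity there: `ℙ` keeps constant fields. -/
def leraySymbol {d : ℕ} (m : Fin d → ℤ) (i j : Fin d) : ℝ :=
  (if i = j then 1 else 0) - (m i : ℝ) * (m j : ℝ) / freqNorm m ^ 2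

/-- The Fourier coefficient at `m` of the `i`-th component of an integrable field `f`. -/
def fieldCoeff {d : ℕ} (f : Torus d → Vec d) (m : Fin d → ℤ) (i : Fin d) : ℂ :=
  UnitAddTorus.mFourierCoeff (fun x => ((f x i : ℝ) : ℂ)) m

/-- The Fourier coefficient at `m` of the entry `fᵢ fⱼ` of the tensor product `f ⊗ f`
of a square integrable field `f`. -/
def tensorCoeff {d : ℕ} (f : Torus d → Vec d) (m : Fin d → ℤ) (i j : Fin d) : ℂ :=
  UnitAddTorus.mFourierCoeff (fun x => ((f x i * f x j : ℝ) : ℂ)) m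

/-- The Fourier coefficients of the `i`-th component of the distribution `ℙ div (f ⊗ f)`,
where `(div A)ₖ = ∑ⱼ ∂ⱼ Aₖⱼ`. -/
def lerayDivCoeff {d : ℕ} (f : Torus d → Vec d) (m : Fin d → ℤ) (i : Fin d) : ℂ :=
  ∑ k, (leraySymbol m i k : ℂ) *
    ∑ j, (2 * Real.pi * Complex.I * (m j : ℂ)) * tensorCoeff f m k j

/-- The Fourier coefficients of the `i`-th component of `e^{-t(-Δ)^α} f`. -/
def heatCoeff {d : ℕ} (α : ℝ) (f : Torus d → Vec d) (t : ℝ) (m : Fin d → ℤ) (i : Fin d) : ℂ :=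
  (heatSymbol α t m : ℂ) * fieldCoeff f m i

/-- The Fourier coefficients of the `i`-th component of the distribution
`B_α(u,u)(t) = ∫₀ᵗ e^{-(t-s)(-Δ)^α} ℙ div (u ⊗ u)(s) ds`. -/
def bilinearCoeff {d : ℕ} (α : ℝ) (u : ℝ → Torus d → Vec d) (t : ℝ) (m : Fin d → ℤ)
    (i : Fin d) : ℂ :=
  ∫ s in (0 : ℝ)..t, (heatSymbol α (t - s) m : ℂ) * lerayDivCoeff (u s) m i

/-- The dual pairing `⟨F, ψ⟩ = ∑ₘ F̂(m) ψ̂(-m)` of the distribution `F = ∑ₘ F̂(m) e^{2πi m·x}` on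
`𝕋ᵈ`, given by its (polynomially bounded) Fourier coefficients `c = F̂`, with `ψ ∈ C^∞(𝕋ᵈ)`. -/
def pairing {d : ℕ} (c : (Fin d → ℤ) → ℂ) (ψ : Torus d → ℂ) : ℂ :=
  ∑' m : Fin d → ℤ, c m * UnitAddTorus.mFourierCoeff ψ (-m)

/-- `u` is a mild solution on `(0,T)` of the fractional Navier-Stokes equations with initial
data `u₀`: the identity `u(t) = e^{-t(-Δ)^α} u₀ - B_α(u,u)(t)` holds, component by component,
in `𝒟'((0,T) × 𝕋ᵈ)`. It is used for `u` continuous in time with values in `L^p`, `p ≥ 2`, so that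
`u ⊗ u` is an integrable function of `x`, with integral continuous in time. -/
def IsMildSolution {d : ℕ} (α T : ℝ) (u₀ : Torus d → Vec d) (u : ℝ → Torus d → Vec d) : Prop :=
  ∀ φ : ℝ → Torus d → ℂ, IsTestFunction T φ → ∀ i : Fin d,
    ∫ t in (0 : ℝ)..T, (∫ x, ((u t x i : ℝ) : ℂ) * φ t x ∂torusMeasure d) =
      (∫ t in (0 : ℝ)..T, pairing (fun m => heatCoeff α u₀ t m i) (φ t)) -
        ∫ t in (0 : ℝ)..T, pairing (fun m => bilinearCoeff α u t m i) (φ t)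

end FracNS

end

namespace FracNS

open UnitAddTorus
open scoped ComplexConjugate

/-! The difference w = u - v is estimated in L² in space only, where Parseval turns everything into
sums over frequencies; the L^p hypothesis serves to bound u and v in L^q for a finite q ≤ p with q ≥
2 and β = 2α - 1 - d/q > 0 (`exists_subcritical_exponent`).

Testing with single Fourier modes gives Duhamel's formula for each coefficient at each time
(`IsMildSolution.fieldCoeff_eq`), so the coefficients of w are damped time integrals of those of ℙ
div(u⊗u - v⊗v). Each entry of that tensor is a sum of products of a component of w with one of u or
v. On a block of frequencies of size 2^j, such a product of an L² and an L^q function has ℓ² norm at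
most of order 2^(jd/q) ‖w‖₂ (`sum_sq_norm_mFourierCoeff_mul_le`), and the derivative costs 2^j.

If ‖w(s)‖₂² ≤ W e^(2Ks), integrating e^(Ks) against the heat kernel gains 1/(2^(2αj) + K)
(`sum_sq_norm_integral_le`). After squaring, the balance on the block is at most a constant times
2^(-βj) K^(-β/(2α)) (`dyadic_power_le`). Summing over j reproduces the hypothesis with W multiplied
by C K^(-β/(2α)). For K large this factor is at most 1/2, and iteration forces w = 0 on all of [0,T]
at once. -/

/-! ### Parseval and trigonometric polynomials -/

theorem mFourierCoeff_def {d : ℕ} (f : Torus d → ℂ) (m : Fin d → ℤ) :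
    mFourierCoeff f m = ∫ x, mFourier (-m) x * f x ∂torusMeasure d := rfl

theorem norm_mFourier_apply {d : ℕ} (m : Fin d → ℤ) (x : Torus d) : ‖mFourier m x‖ = 1 := by
  simp only [mFourier, fourier_apply, ContinuousMap.coe_mk, norm_prod, Circle.norm_coe,
    Finset.prod_const_one]

/-- Parseval's identity for a square integrable function. -/
theorem hasSum_sq_norm_mFourierCoeff {d : ℕ} {f : Torus d → ℂ}
    (hf : MemLp f 2 (torusMeasure d)) :
    HasSum (fun m => ‖mFourierCoeff f m‖ ^ 2) (∫ x, ‖f x‖ ^ 2 ∂torusMeasure d) := by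
  have h := hasSum_sq_mFourierCoeff (d := Fin d) hf.toLp
  have h1 : ∀ m, mFourierCoeff hf.toLp m = mFourierCoeff f m := fun m =>
    integral_congr_ae (by filter_upwards [hf.coeFn_toLp] with x hx; rw [hx])
  have h2 : (∫ x, ‖hf.toLp f x‖ ^ 2 ∂torusMeasure d) = ∫ x, ‖f x‖ ^ 2 ∂torusMeasure d :=
    integral_congr_ae (by filter_upwards [hf.coeFn_toLp] with x hx; rw [hx])
  rw [← h2]
  convert! h using 3 with m
  rw [h1]

theorem mFourierCoeff_mFourier {d : ℕ} (n m : Fin d → ℤ) :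
    mFourierCoeff (fun x => mFourier n x) m = if m = n then 1 else 0 := by
  have h := orthonormal_iff_ite.1 (orthonormal_mFourier (d := Fin d)) m n
  rw [← h, ContinuousMap.inner_toLp]
  exact integral_congr_ae (.of_forall fun x => by simp [mFourier_neg, mul_comm])

theorem memLp_of_continuous {d : ℕ} {f : Torus d → ℂ} (hf : Continuous f) (p : ℝ≥0∞) :
    MemLp f p (torusMeasure d) := by
  obtain ⟨C, hC⟩ := isCompact_univ.exists_bound_of_continuousOn (f := f) hf.continuousOn
  exact MemLp.of_bound hf.aestronglyMeasurable C (.of_forall fun x => hC x (mem_univ x))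

theorem integral_sq_norm_trigPoly {d : ℕ} (A : Finset (Fin d → ℤ)) (c : (Fin d → ℤ) → ℂ) :
    ∫ x, ‖∑ m ∈ A, c m * mFourier m x‖ ^ 2 ∂torusMeasure d = ∑ m ∈ A, ‖c m‖ ^ 2 := by
  classical
  have hcont : Continuous fun x : Torus d => ∑ m ∈ A, c m * mFourier m x := by fun_prop
  have h := hasSum_sq_norm_mFourierCoeff (memLp_of_continuous hcont 2)
  have hc : ∀ n, mFourierCoeff (fun x : Torus d => ∑ m ∈ A, c m * mFourier m x) n =
      if n ∈ A then c n else 0 := by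
    intro n
    rw [mFourierCoeff_def]
    simp_rw [Finset.mul_sum]
    rw [integral_finsetSum]
    · calc _ = ∑ m ∈ A, c m * mFourierCoeff (fun x => mFourier m x) n := by
            refine Finset.sum_congr rfl fun m _ => ?_
            rw [mFourierCoeff_def, ← integral_const_mul]
            exact integral_congr_ae (.of_forall fun x => by ring)
        _ = _ := by simp [mFourierCoeff_mFourier]
    · intro m _
      exact memLp_one_iff_integrable.1 (memLp_of_continuous (by fun_prop) 1)
  simp_rw [hc] at h
  refine h.unique ?_
  have := hasSum_sum_of_ne_finset_zero (L := .unconditional _)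
    (f := fun n => ‖if n ∈ A then c n else 0‖ ^ 2) (s := A)
    (fun n hn => by simp [hn])
  convert! this using 1
  exact Finset.sum_congr rfl fun m hm => by simp [hm]

/-- Cauchy–Schwarz over the modes: a Bernstein inequality from L² to L^∞, and the source of the loss
in the number of frequencies. -/
theorem sq_norm_trigPoly_le {d : ℕ} (A : Finset (Fin d → ℤ)) (c : (Fin d → ℤ) → ℂ) (x : Torus d) :
    ‖∑ m ∈ A, c m * mFourier m x‖ ^ 2 ≤ A.card * ∑ m ∈ A, ‖c m‖ ^ 2 := by
  calc _ ≤ (∑ m ∈ A, ‖c m‖) ^ 2 := by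
        gcongr
        refine (norm_sum_le _ _).trans (Finset.sum_le_sum fun m _ => ?_)
        rw [norm_mul, norm_mFourier_apply, mul_one]
    _ ≤ _ := sq_sum_le_card_mul_sum_sq

/-! ### Products on a finite block of frequencies -/

/-- Hölder's inequality with one factor interpolated between `L²` and `L^∞`. -/
theorem lintegral_sq_mul_sq_le {X : Type*} [MeasurableSpace X] {μ : Measure X} {g h : X → ℝ≥0∞}
    (hg : AEMeasurable g μ) (hh : AEMeasurable h μ) {q : ℝ} (hq : 2 ≤ q) {K : ℝ≥0∞}
    (hK : ∀ x, h x ^ 2 ≤ K) :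
    ∫⁻ x, g x ^ 2 * h x ^ 2 ∂μ ≤
      (∫⁻ x, g x ^ q ∂μ) ^ (2 / q) * (∫⁻ x, h x ^ 2 ∂μ) ^ (1 - 2 / q) * K ^ (2 / q) := by
  have hq0 : 0 < q := by linarith
  have hq1 : 0 ≤ 1 - 2 / q := by
    rw [sub_nonneg, div_le_one hq0]; exact hq
  calc ∫⁻ x, g x ^ 2 * h x ^ 2 ∂μ
      ≤ ∫⁻ x, (g x ^ q) ^ (2 / q) * (h x ^ 2) ^ (1 - 2 / q) * K ^ (2 / q) ∂μ := by
        refine lintegral_mono fun x => ?_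
        rw [← ENNReal.rpow_mul, mul_div_cancel₀ _ hq0.ne', ENNReal.rpow_two, mul_assoc]
        gcongr
        calc h x ^ 2 = (h x ^ 2) ^ (1 - 2 / q) * (h x ^ 2) ^ (2 / q) := by
              rw [← ENNReal.rpow_add_of_nonneg _ _ hq1 (by positivity)]; simp
          _ ≤ _ := by gcongr; exact hK x
    _ = (∫⁻ x, (g x ^ q) ^ (2 / q) * (h x ^ 2) ^ (1 - 2 / q) ∂μ) * K ^ (2 / q) := by
        rw [lintegral_mul_const'']
        exact ((hg.pow_const q).pow_const _).mul ((hh.pow_const 2).pow_const _)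
    _ ≤ _ := by
        gcongr
        exact ENNReal.lintegral_mul_norm_pow_le (hg.pow_const q) (hh.pow_const 2) (by positivity)
          hq1 (by ring)

theorem sq_lintegral_mul_le {X : Type*} [MeasurableSpace X] {μ : Measure X} {g h : X → ℝ≥0∞}
    (hg : AEMeasurable g μ) (hh : AEMeasurable h μ) :
    (∫⁻ x, g x * h x ∂μ) ^ 2 ≤ (∫⁻ x, g x ^ 2 ∂μ) * ∫⁻ x, h x ^ 2 ∂μ := by
  have h1 := ENNReal.lintegral_mul_norm_pow_le (hg.pow_const 2) (hh.pow_const 2)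
    (p := 1 / 2) (q := 1 / 2) (by norm_num) (by norm_num) (by norm_num)
  have e : ∀ a : ℝ≥0∞, (a ^ 2) ^ (1 / 2 : ℝ) = a := fun a => by
    rw [← ENNReal.rpow_two, ← ENNReal.rpow_mul]; norm_num
  have e' : ∀ a : ℝ≥0∞, (a ^ (1 / 2 : ℝ)) ^ 2 = a := fun a => by
    rw [← ENNReal.rpow_two, ← ENNReal.rpow_mul]; norm_num
  simp_rw [e] at h1
  calc _ ≤ _ := pow_le_pow_left₀ (zero_le) h1 2
    _ = _ := by rw [mul_pow, e', e']

/-- A finite block of Fourier coefficients of a product of an `L²` function and an `L^q` function: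
the price for landing in `ℓ²` is the factor `(#A)^(2/q)`. -/
theorem sum_sq_norm_mFourierCoeff_mul_le {d : ℕ} {f g : Torus d → ℝ}
    (hf : AEStronglyMeasurable f (torusMeasure d)) (hg : AEStronglyMeasurable g (torusMeasure d))
    {q F M : ℝ} (hq : 2 ≤ q) (hF0 : 0 ≤ F) (hM0 : 0 ≤ M)
    (hF : ∫⁻ x, ‖f x‖ₑ ^ 2 ∂torusMeasure d ≤ ENNReal.ofReal F)
    (hM : (∫⁻ x, ‖g x‖ₑ ^ q ∂torusMeasure d) ^ (2 / q) ≤ ENNReal.ofReal M)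
    (hfg : Integrable (fun x => ((f x * g x : ℝ) : ℂ)) (torusMeasure d))
    (A : Finset (Fin d → ℤ)) :
    ∑ m ∈ A, ‖mFourierCoeff (fun x => ((f x * g x : ℝ) : ℂ)) m‖ ^ 2 ≤
      (A.card : ℝ) ^ (2 / q) * (F * M) := by
  have hq0 : 0 < q := by linarith
  have hq1 : 0 ≤ 1 - 2 / q := by
    rw [sub_nonneg, div_le_one hq0]; exact hq
  set c : (Fin d → ℤ) → ℂ := mFourierCoeff (fun x => ((f x * g x : ℝ) : ℂ)) with hc
  set S : ℝ := ∑ m ∈ A, ‖c m‖ ^ 2 with hS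
  have hS0 : 0 ≤ S := by positivity
  -- Duality: ψ is the projection of f g onto the modes in A, so pairing f g with ψ returns S, and
  -- ‖ψ‖₂² = S as well.
  set ψ : Torus d → ℂ := fun x => ∑ m ∈ A, c m * mFourier m x with hψ
  have hψc : Continuous ψ := by fun_prop
  have hψ2 : ∫⁻ x, ‖ψ x‖ₑ ^ 2 ∂torusMeasure d = ENNReal.ofReal S := by
    rw [hS, ← integral_sq_norm_trigPoly, ofReal_integral_eq_lintegral_ofReal]
    · refine lintegral_congr fun x => ?_
      rw [← ofReal_norm, ENNReal.ofReal_pow (norm_nonneg _)]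
    · exact (memLp_of_continuous hψc 2).integrable_norm_pow (by norm_num)
    · exact .of_forall fun x => by positivity
  have hψK : ∀ x, ‖ψ x‖ₑ ^ 2 ≤ ENNReal.ofReal (A.card * S) := fun x => by
    rw [← ofReal_norm, ← ENNReal.ofReal_pow (norm_nonneg _)]
    exact ENNReal.ofReal_le_ofReal (sq_norm_trigPoly_le A c x)
  have hpair : ((S : ℝ) : ℂ) = ∫ x, conj (ψ x) * ((f x * g x : ℝ) : ℂ) ∂torusMeasure d := by
    simp_rw [hψ, map_sum, map_mul, Finset.sum_mul]
    rw [integral_finsetSum, hS, Complex.ofReal_sum]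
    · refine Finset.sum_congr rfl fun m _ => ?_
      have : ∀ x, conj (c m) * conj (mFourier m x) * ((f x * g x : ℝ) : ℂ) =
          conj (c m) * (mFourier (-m) x * ((f x * g x : ℝ) : ℂ)) := fun x => by
        rw [mFourier_neg]; ring
      simp_rw [this]
      rw [integral_const_mul, ← mFourierCoeff_def, ← hc, Complex.conj_mul', Complex.ofReal_pow]
    · intro m _
      refine hfg.bdd_mul (c := ‖c m‖) (Continuous.aestronglyMeasurable (by fun_prop))
        (.of_forall fun x => ?_)
      simp [norm_mFourier_apply]
  have h1 : ENNReal.ofReal S ≤ ∫⁻ x, ‖f x‖ₑ * (‖g x‖ₑ * ‖ψ x‖ₑ) ∂torusMeasure d := by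
    calc ENNReal.ofReal S = ‖((S : ℝ) : ℂ)‖ₑ := by
          rw [← ofReal_norm, Complex.norm_real, Real.norm_of_nonneg hS0]
      _ ≤ ∫⁻ x, ‖conj (ψ x) * ((f x * g x : ℝ) : ℂ)‖ₑ ∂torusMeasure d := by
          rw [hpair]; exact enorm_integral_le_lintegral_enorm _
      _ = _ := by
          refine lintegral_congr fun x => ?_
          rw [← ofReal_norm, ← ofReal_norm, ← ofReal_norm, ← ofReal_norm,
            ← ENNReal.ofReal_mul (norm_nonneg _), ← ENNReal.ofReal_mul (norm_nonneg _)]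
          congr 1
          rw [norm_mul, RCLike.norm_conj, Complex.norm_real, norm_mul]
          ring
  have h2 : ENNReal.ofReal S ^ 2 ≤ ENNReal.ofReal (((A.card : ℝ) ^ (2 / q) * (F * M)) * S) := by
    calc ENNReal.ofReal S ^ 2
        ≤ (∫⁻ x, ‖f x‖ₑ * (‖g x‖ₑ * ‖ψ x‖ₑ) ∂torusMeasure d) ^ 2 := by gcongr
      _ ≤ (∫⁻ x, ‖f x‖ₑ ^ 2 ∂torusMeasure d) *
            ∫⁻ x, (‖g x‖ₑ * ‖ψ x‖ₑ) ^ 2 ∂torusMeasure d :=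
          sq_lintegral_mul_le hf.enorm (hg.enorm.mul hψc.aestronglyMeasurable.enorm)
      _ ≤ ENNReal.ofReal F * (ENNReal.ofReal M * ENNReal.ofReal S ^ (1 - 2 / q) *
            ENNReal.ofReal (A.card * S) ^ (2 / q)) := by
          gcongr
          simp_rw [mul_pow]
          refine (lintegral_sq_mul_sq_le hg.enorm hψc.aestronglyMeasurable.enorm hq hψK).trans ?_
          rw [hψ2]
          gcongr
      _ = _ := by
          rw [ENNReal.ofReal_rpow_of_nonneg hS0 hq1,
            ENNReal.ofReal_rpow_of_nonneg (by positivity) (by positivity),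
            ← ENNReal.ofReal_mul hM0, ← ENNReal.ofReal_mul (by positivity),
            ← ENNReal.ofReal_mul hF0]
          congr 1
          rw [Real.mul_rpow (by positivity) hS0]
          have : S ^ (1 - 2 / q) * S ^ (2 / q) = S := by
            rw [← Real.rpow_add_of_nonneg hS0 hq1 (by positivity)]; simp
          calc _ = (A.card : ℝ) ^ (2 / q) * (F * M) * (S ^ (1 - 2 / q) * S ^ (2 / q)) := by ring
            _ = _ := by rw [this]
  -- The inequality now reads S² ≤ (bound) · S; one factor S is cancelled.
  rw [← ENNReal.ofReal_pow hS0, ENNReal.ofReal_le_ofReal_iff (by positivity)] at h2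
  rcases hS0.eq_or_lt with h | h
  · rw [← h]; positivity
  · nlinarith

/-! ### The difference of the nonlinear terms -/

theorem memLp_component {d : ℕ} {f : Torus d → Vec d} {p : ℝ≥0∞} (hf : MemLp f p (torusMeasure d))
    (i : Fin d) : MemLp (fun x => f x i) p (torusMeasure d) :=
  hf.of_le ((EuclideanSpace.proj (𝕜 := ℝ) i).continuous.comp_aestronglyMeasurable
    hf.aestronglyMeasurable) (.of_forall fun x => PiLp.norm_apply_le (f x) i)

theorem enorm_component_le {d : ℕ} (x : Vec d) (i : Fin d) : ‖x i‖ₑ ≤ ‖x‖ₑ := by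
  rw [← ofReal_norm, ← ofReal_norm]
  exact ENNReal.ofReal_le_ofReal (PiLp.norm_apply_le x i)

theorem integrable_component_mul {d : ℕ} {f g : Torus d → Vec d} (hf : MemLp f 2 (torusMeasure d))
    (hg : MemLp g 2 (torusMeasure d)) (i j : Fin d) :
    Integrable (fun x => ((f x i * g x j : ℝ) : ℂ)) (torusMeasure d) :=
  ((memLp_component hf i).integrable_mul (memLp_component hg j)).ofReal

theorem integrable_mFourier_mul {d : ℕ} {f : Torus d → ℂ} (hf : Integrable f (torusMeasure d))
    (m : Fin d → ℤ) : Integrable (fun x => mFourier m x * f x) (torusMeasure d) :=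
  hf.bdd_mul (c := 1) (mFourier m).continuous.aestronglyMeasurable
    (.of_forall fun x => (norm_mFourier_apply m x).le)

theorem mFourierCoeff_add {d : ℕ} {f g : Torus d → ℂ} (hf : Integrable f (torusMeasure d))
    (hg : Integrable g (torusMeasure d)) (m : Fin d → ℤ) :
    mFourierCoeff (fun x => f x + g x) m = mFourierCoeff f m + mFourierCoeff g m := by
  simp_rw [mFourierCoeff_def, mul_add]
  exact integral_add (integrable_mFourier_mul hf _) (integrable_mFourier_mul hg _)

theorem mFourierCoeff_sub {d : ℕ} {f g : Torus d → ℂ} (hf : Integrable f (torusMeasure d))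
    (hg : Integrable g (torusMeasure d)) (m : Fin d → ℤ) :
    mFourierCoeff (fun x => f x - g x) m = mFourierCoeff f m - mFourierCoeff g m := by
  simp_rw [mFourierCoeff_def, mul_sub]
  exact integral_sub (integrable_mFourier_mul hf _) (integrable_mFourier_mul hg _)

/-- With w = u - v, the identity is u_k u_j - v_k v_j = w_k u_j + w_j v_k: each product is linear in
w, the other factor being a solution. -/
theorem tensorCoeff_sub {d : ℕ} {u v : Torus d → Vec d} (hu : MemLp u 2 (torusMeasure d))
    (hv : MemLp v 2 (torusMeasure d)) (m : Fin d → ℤ) (k j : Fin d) :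
    tensorCoeff u m k j - tensorCoeff v m k j =
      mFourierCoeff (fun x => (((u - v) x k * u x j : ℝ) : ℂ)) m +
        mFourierCoeff (fun x => (((u - v) x j * v x k : ℝ) : ℂ)) m := by
  rw [tensorCoeff, tensorCoeff, ← mFourierCoeff_sub (integrable_component_mul hu hu k j)
    (integrable_component_mul hv hv k j),
    ← mFourierCoeff_add (integrable_component_mul (hu.sub hv) hu k j)
      (integrable_component_mul (hu.sub hv) hv j k)]
  congr 1
  funext x
  simp only [Pi.sub_apply, PiLp.sub_apply]
  push_cast
  ring

theorem lintegral_component_sq_le {d : ℕ} {w : Torus d → Vec d} (hw : MemLp w 2 (torusMeasure d))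
    (i : Fin d) : ∫⁻ x, ‖w x i‖ₑ ^ 2 ∂torusMeasure d ≤
      ENNReal.ofReal (∫ x, ‖w x‖ ^ 2 ∂torusMeasure d) := by
  rw [ofReal_integral_eq_lintegral_ofReal (hw.integrable_norm_pow (by norm_num))
    (.of_forall fun x => by positivity)]
  refine lintegral_mono fun x => ?_
  rw [ENNReal.ofReal_pow (norm_nonneg _), ofReal_norm]
  gcongr
  exact enorm_component_le _ _

theorem sum_sq_norm_tensorCoeff_sub_le {d : ℕ} {u v : Torus d → Vec d}
    (hu : MemLp u 2 (torusMeasure d)) (hv : MemLp v 2 (torusMeasure d)) {q M : ℝ} (hq : 2 ≤ q)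
    (hM0 : 0 ≤ M)
    (huM : (∫⁻ x, ‖u x‖ₑ ^ q ∂torusMeasure d) ^ (2 / q) ≤ ENNReal.ofReal M)
    (hvM : (∫⁻ x, ‖v x‖ₑ ^ q ∂torusMeasure d) ^ (2 / q) ≤ ENNReal.ofReal M)
    (A : Finset (Fin d → ℤ)) (k j : Fin d) :
    ∑ m ∈ A, ‖tensorCoeff u m k j - tensorCoeff v m k j‖ ^ 2 ≤
      4 * (A.card : ℝ) ^ (2 / q) * ((∫ x, ‖u x - v x‖ ^ 2 ∂torusMeasure d) * M) := by
  have hw := hu.sub hv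
  set N := ∫ x, ‖u x - v x‖ ^ 2 ∂torusMeasure d with hN
  have hN0 : 0 ≤ N := integral_nonneg fun x => by positivity
  have hcomp : ∀ (g : Torus d → Vec d) (i : Fin d),
      (∫⁻ x, ‖g x‖ₑ ^ q ∂torusMeasure d) ^ (2 / q) ≤ ENNReal.ofReal M →
      (∫⁻ x, ‖g x i‖ₑ ^ q ∂torusMeasure d) ^ (2 / q) ≤ ENNReal.ofReal M := fun g i h => by
    refine le_trans ?_ h
    gcongr with x
    exact enorm_component_le _ _
  have h1 := sum_sq_norm_mFourierCoeff_mul_le (memLp_component hw k).aestronglyMeasurable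
    (memLp_component hu j).aestronglyMeasurable hq hN0 hM0 (lintegral_component_sq_le hw k)
    (hcomp u j huM) (integrable_component_mul hw hu k j) A
  have h2 := sum_sq_norm_mFourierCoeff_mul_le (memLp_component hw j).aestronglyMeasurable
    (memLp_component hv k).aestronglyMeasurable hq hN0 hM0 (lintegral_component_sq_le hw j)
    (hcomp v k hvM) (integrable_component_mul hw hv j k) A
  calc _ ≤ ∑ m ∈ A, (2 * ‖mFourierCoeff (fun x => (((u - v) x k * u x j : ℝ) : ℂ)) m‖ ^ 2 +
        2 * ‖mFourierCoeff (fun x => (((u - v) x j * v x k : ℝ) : ℂ)) m‖ ^ 2) := by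
        refine Finset.sum_le_sum fun m _ => ?_
        rw [tensorCoeff_sub hu hv]
        have h3 := norm_add_le (mFourierCoeff (fun x => (((u - v) x k * u x j : ℝ) : ℂ)) m)
          (mFourierCoeff (fun x => (((u - v) x j * v x k : ℝ) : ℂ)) m)
        refine (pow_le_pow_left₀ (norm_nonneg _) h3 2).trans ?_
        nlinarith [sq_nonneg (‖mFourierCoeff (fun x => (((u - v) x k * u x j : ℝ) : ℂ)) m‖ -
          ‖mFourierCoeff (fun x => (((u - v) x j * v x k : ℝ) : ℂ)) m‖)]
    _ ≤ _ := by
        rw [Finset.sum_add_distrib, ← Finset.mul_sum, ← Finset.mul_sum]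
        linarith

theorem abs_apply_le_freqNorm {d : ℕ} (m : Fin d → ℤ) (i : Fin d) : |(m i : ℝ)| ≤ freqNorm m := by
  refine Real.abs_le_sqrt ?_
  exact Finset.single_le_sum (f := fun i => (m i : ℝ) ^ 2) (fun _ _ => sq_nonneg _)
    (Finset.mem_univ i)

theorem abs_leraySymbol_le {d : ℕ} (m : Fin d → ℤ) (i j : Fin d) : |leraySymbol m i j| ≤ 2 := by
  have h1 : |(m i : ℝ) * (m j : ℝ) / freqNorm m ^ 2| ≤ 1 := by
    rw [abs_div, abs_mul, abs_of_nonneg (sq_nonneg (freqNorm m))]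
    refine div_le_one_of_le₀ ?_ (sq_nonneg _)
    rw [sq]
    exact mul_le_mul (abs_apply_le_freqNorm m i) (abs_apply_le_freqNorm m j) (abs_nonneg _)
      (Real.sqrt_nonneg _)
  have h2 : |(if i = j then (1 : ℝ) else 0)| ≤ 1 := by split_ifs <;> simp
  exact (abs_sub _ _).trans (by linarith)

theorem norm_lerayDivCoeff_sub_le {d : ℕ} (u v : Torus d → Vec d) (m : Fin d → ℤ) {R : ℝ}
    (hR : ∀ j, |(m j : ℝ)| ≤ R) (i : Fin d) :
    ‖lerayDivCoeff u m i - lerayDivCoeff v m i‖ ≤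
      ∑ k, ∑ j, 4 * Real.pi * R * ‖tensorCoeff u m k j - tensorCoeff v m k j‖ := by
  simp_rw [lerayDivCoeff, ← Finset.sum_sub_distrib, ← mul_sub, ← Finset.sum_sub_distrib, ← mul_sub,
    Finset.mul_sum]
  refine (norm_sum_le _ _).trans (Finset.sum_le_sum fun k _ => ?_)
  refine (norm_sum_le _ _).trans (Finset.sum_le_sum fun j _ => ?_)
  rw [norm_mul, norm_mul, ← mul_assoc]
  refine mul_le_mul_of_nonneg_right ?_ (norm_nonneg _)
  have h1 : ‖(2 * Real.pi * Complex.I * (m j : ℂ))‖ = 2 * Real.pi * |(m j : ℝ)| := by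
    rw [norm_mul, norm_mul, norm_mul, Complex.norm_I, Complex.norm_intCast, Complex.norm_real,
      Real.norm_of_nonneg Real.pi_pos.le]
    simp
  rw [h1, Complex.norm_real, Real.norm_eq_abs]
  have hpi := Real.pi_pos
  calc _ ≤ 2 * (2 * Real.pi * R) := by
        gcongr
        · exact abs_leraySymbol_le m i k
        · exact hR j
    _ = _ := by ring

/-- The factor 64 π² d⁴ is (4π)² from the derivative and the crude bound 2 on the Leray symbol, 4
from the tensor estimate, d² from Cauchy–Schwarz over the pairs (k, j), and d² from summing over
them. -/
theorem sum_sq_norm_lerayDivCoeff_sub_le {d : ℕ} {u v : Torus d → Vec d}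
    (hu : MemLp u 2 (torusMeasure d)) (hv : MemLp v 2 (torusMeasure d)) {q M R : ℝ} (hq : 2 ≤ q)
    (hM0 : 0 ≤ M)
    (huM : (∫⁻ x, ‖u x‖ₑ ^ q ∂torusMeasure d) ^ (2 / q) ≤ ENNReal.ofReal M)
    (hvM : (∫⁻ x, ‖v x‖ₑ ^ q ∂torusMeasure d) ^ (2 / q) ≤ ENNReal.ofReal M)
    (A : Finset (Fin d → ℤ)) (hR : ∀ m ∈ A, ∀ j, |(m j : ℝ)| ≤ R) (i : Fin d) :
    ∑ m ∈ A, ‖lerayDivCoeff u m i - lerayDivCoeff v m i‖ ^ 2 ≤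
      (64 * Real.pi ^ 2 * (d : ℝ) ^ 4 * M) * R ^ 2 * (A.card : ℝ) ^ (2 / q) *
        ∫ x, ‖u x - v x‖ ^ 2 ∂torusMeasure d := by
  set N := ∫ x, ‖u x - v x‖ ^ 2 ∂torusMeasure d with hN
  calc _ ≤ ∑ m ∈ A, ∑ k, ∑ j, 16 * Real.pi ^ 2 * R ^ 2 * (d : ℝ) ^ 2 *
        ‖tensorCoeff u m k j - tensorCoeff v m k j‖ ^ 2 := by
        refine Finset.sum_le_sum fun m hm => ?_
        refine (pow_le_pow_left₀ (norm_nonneg _)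
          (norm_lerayDivCoeff_sub_le u v m (hR m hm) i) 2).trans ?_
        refine sq_sum_le_card_mul_sum_sq.trans ?_
        rw [Finset.card_univ, Fintype.card_fin, Finset.mul_sum]
        refine Finset.sum_le_sum fun k _ => ?_
        refine (mul_le_mul_of_nonneg_left sq_sum_le_card_mul_sum_sq (Nat.cast_nonneg d)).trans ?_
        rw [Finset.card_univ, Fintype.card_fin, Finset.mul_sum, Finset.mul_sum]
        refine Finset.sum_le_sum fun j _ => le_of_eq ?_
        ring
    _ = ∑ k, ∑ j, 16 * Real.pi ^ 2 * R ^ 2 * (d : ℝ) ^ 2 *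
        ∑ m ∈ A, ‖tensorCoeff u m k j - tensorCoeff v m k j‖ ^ 2 := by
        rw [Finset.sum_comm]
        refine Finset.sum_congr rfl fun k _ => ?_
        rw [Finset.sum_comm]
        exact Finset.sum_congr rfl fun j _ => (Finset.mul_sum _ _ _).symm
    _ ≤ ∑ _k : Fin d, ∑ _j : Fin d, 16 * Real.pi ^ 2 * R ^ 2 * (d : ℝ) ^ 2 *
        (4 * (A.card : ℝ) ^ (2 / q) * (N * M)) := by
        gcongr with k _ j _
        exact sum_sq_norm_tensorCoeff_sub_le hu hv hq hM0 huM hvM A k j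
    _ = _ := by
        simp only [Finset.sum_const, Finset.card_univ, Fintype.card_fin, nsmul_eq_mul]
        ring

theorem integral_sq_norm_le_of_fieldCoeff {d : ℕ} {w : Torus d → Vec d}
    (hw : MemLp w 2 (torusMeasure d)) {D : ℝ}
    (h : ∀ (B : Finset (Fin d → ℤ)) (i : Fin d), ∑ m ∈ B, ‖fieldCoeff w m i‖ ^ 2 ≤ D) :
    ∫ x, ‖w x‖ ^ 2 ∂torusMeasure d ≤ d * D := by
  have h1 : ∀ i, MemLp (fun x => ((w x i : ℝ) : ℂ)) 2 (torusMeasure d) :=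
    fun i => (memLp_component hw i).ofReal
  calc ∫ x, ‖w x‖ ^ 2 ∂torusMeasure d
      = ∫ x, ∑ i, ‖((w x i : ℝ) : ℂ)‖ ^ 2 ∂torusMeasure d := by
        simp_rw [EuclideanSpace.norm_sq_eq, Complex.norm_real]
    _ = ∑ i, ∫ x, ‖((w x i : ℝ) : ℂ)‖ ^ 2 ∂torusMeasure d :=
        integral_finsetSum _ fun i _ => (h1 i).integrable_norm_pow (by norm_num)
    _ ≤ ∑ _i : Fin d, D := by
        refine Finset.sum_le_sum fun i _ => ?_
        exact hasSum_le_of_sum_le (hasSum_sq_norm_mFourierCoeff (h1 i)) fun B => h B i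
    _ = _ := by simp

/-! ### Testing with single Fourier modes -/

theorem mFourier_toTorus {d : ℕ} (m : Fin d → ℤ) (y : Fin d → ℝ) :
    mFourier m (toTorus y) = ∏ i, Complex.exp (2 * Real.pi * Complex.I * (m i : ℂ) * (y i : ℂ)) := by
  simp [mFourier, toTorus]

theorem isTestFunction_smul_mFourier {d : ℕ} {T : ℝ} (hT : 0 < T) {χ : ℝ → ℝ}
    (hχ : ContDiff ℝ (⊤ : ℕ∞) χ) (hc : HasCompactSupport χ) (hs : tsupport χ ⊆ Ioo 0 T)
    (m : Fin d → ℤ) : IsTestFunction T (fun t x => (χ t : ℂ) * mFourier m x) := by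
  constructor
  · simp_rw [mFourier_toTorus]
    refine ContDiff.mul (Complex.ofRealCLM.contDiff.comp (hχ.comp contDiff_fst)) ?_
    refine contDiff_prod fun i _ => ContDiff.cexp (contDiff_const.mul ?_)
    exact Complex.ofRealCLM.contDiff.comp ((contDiff_apply ℝ ℝ i).comp contDiff_snd)
  · rcases (tsupport χ).eq_empty_or_nonempty with h | h
    · refine ⟨T / 2, T / 2, by linarith, by linarith, fun t _ x => ?_⟩
      rw [tsupport_eq_empty_iff] at h
      simp [h]
    · obtain ⟨a, ha, ha'⟩ := hc.isCompact.exists_isLeast h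
      obtain ⟨b, hb, hb'⟩ := hc.isCompact.exists_isGreatest h
      refine ⟨a, b, (hs ha).1, (hs hb).2, fun t ht x => ?_⟩
      have : χ t = 0 := image_eq_zero_of_notMem_tsupport fun h' => ht ⟨ha' h', hb' h'⟩
      simp [this]

/-- Orthogonality leaves one term of the series, so no growth condition on c is needed. -/
theorem pairing_smul_mFourier {d : ℕ} (c : (Fin d → ℤ) → ℂ) (a : ℂ) (m : Fin d → ℤ) :
    pairing c (fun x => a * mFourier (-m) x) = a * c m := by
  have h : ∀ n, mFourierCoeff (fun x : Torus d => a * mFourier (-m) x) (-n) =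
      if n = m then a else 0 := fun n => by
    have h1 : mFourierCoeff (fun x : Torus d => a * mFourier (-m) x) (-n) =
        a * mFourierCoeff (fun x => mFourier (-m) x) (-n) := by
      rw [mFourierCoeff_def, mFourierCoeff_def, ← integral_const_mul]
      exact integral_congr_ae (.of_forall fun x => by ring)
    rw [h1, mFourierCoeff_mFourier]
    simp
  rw [pairing, tsum_eq_single m (fun n hn => by rw [h, if_neg hn, mul_zero]), h, if_pos rfl,
    mul_comm]

theorem integral_mul_smul_mFourier {d : ℕ} (f : Torus d → Vec d) (a : ℂ) (m : Fin d → ℤ)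
    (i : Fin d) : ∫ x, ((f x i : ℝ) : ℂ) * (a * mFourier (-m) x) ∂torusMeasure d =
      a * fieldCoeff f m i := by
  rw [fieldCoeff, mFourierCoeff_def, ← integral_const_mul]
  exact integral_congr_ae (.of_forall fun x => by ring)

/-- The fundamental lemma of the calculus of variations on a compact interval. -/
theorem eq_zero_on_Icc_of_integral_smul_eq_zero {T : ℝ} (hT : 0 < T) {E : ℝ → ℂ}
    (hE : ContinuousOn E (Icc 0 T))
    (h : ∀ χ : ℝ → ℝ, ContDiff ℝ (⊤ : ℕ∞) χ → HasCompactSupport χ → tsupport χ ⊆ Ioo 0 T →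
      ∫ t in (0 : ℝ)..T, (χ t : ℂ) * E t = 0) :
    ∀ t ∈ Icc 0 T, E t = 0 := by
  have h1 : ∀ᵐ t ∂(volume : Measure ℝ), t ∈ Ioo 0 T → E t = 0 := by
    refine isOpen_Ioo.ae_eq_zero_of_integral_contDiff_smul_eq_zero
      ((hE.mono Ioo_subset_Icc_self).locallyIntegrableOn measurableSet_Ioo) fun χ h1 h2 h3 => ?_
    rw [← h χ h1 h2 h3, intervalIntegral.integral_of_le hT.le,
      setIntegral_eq_integral_of_forall_compl_eq_zero]
    · exact integral_congr_ae (.of_forall fun t => by simp)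
    · intro t ht
      have : χ t = 0 := image_eq_zero_of_notMem_tsupport fun h' =>
        ht (Ioo_subset_Ioc_self (h3 h'))
      simp [this]
  -- The endpoints are null, so continuity carries the vanishing to them as well.
  have h2 : E =ᵐ[volume.restrict (Icc 0 T)] fun _ => 0 := by
    rw [← restrict_Ioo_eq_restrict_Icc]
    exact (ae_restrict_iff' measurableSet_Ioo).2 h1
  exact Measure.eqOn_Icc_of_ae_eq volume hT.ne h2 hE continuousOn_const

/-! ### Norms of fields and continuity of coefficients in time -/

theorem memLp_of_le {d : ℕ} {p q : ℝ≥0∞} (hqp : q ≤ p) (f : LpField d p) :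
    MemLp (fun x => f x) q (torusMeasure d) := (Lp.memLp f).mono_exponent hqp

/-- The torus has mass one, so L^q norms increase with the exponent, without a constant. -/
theorem lintegral_rpow_le_norm_sq {d : ℕ} {p : ℝ≥0∞} [Fact (1 ≤ p)] {q : ℝ} (hq : 0 < q)
    (hqp : ENNReal.ofReal q ≤ p) (f : LpField d p) :
    (∫⁻ x, ‖f x‖ₑ ^ q ∂torusMeasure d) ^ (2 / q) ≤ ENNReal.ofReal (‖f‖ ^ 2) := by
  have h1 : eLpNorm f (ENNReal.ofReal q) (torusMeasure d) ≤ ENNReal.ofReal ‖f‖ := by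
    rw [Lp.norm_def, ENNReal.ofReal_toReal (Lp.eLpNorm_ne_top f)]
    exact eLpNorm_le_eLpNorm_of_exponent_le hqp (Lp.aestronglyMeasurable f)
  rw [eLpNorm_eq_lintegral_rpow_enorm_toReal (by simpa using hq) ENNReal.ofReal_ne_top,
    ENNReal.toReal_ofReal hq.le] at h1
  rw [ENNReal.ofReal_pow (norm_nonneg _)]
  calc _ = ((∫⁻ x, ‖f x‖ₑ ^ q ∂torusMeasure d) ^ (1 / q)) ^ 2 := by
        rw [← ENNReal.rpow_two, ← ENNReal.rpow_mul]
        congr 1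
        ring
    _ ≤ _ := by gcongr

theorem integral_sq_norm_sub_le {d : ℕ} {p : ℝ≥0∞} [Fact (1 ≤ p)] (hp : 2 ≤ p) (f g : LpField d p) :
    ∫ x, ‖f x - g x‖ ^ 2 ∂torusMeasure d ≤ ‖f - g‖ ^ 2 := by
  have h := lintegral_rpow_le_norm_sq (q := 2) two_pos (by simpa using hp) (f - g)
  rw [div_self two_ne_zero, ENNReal.rpow_one] at h
  have e : ∫ x, ‖f x - g x‖ ^ 2 ∂torusMeasure d = ∫ x, ‖(f - g) x‖ ^ 2 ∂torusMeasure d :=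
    integral_congr_ae (by filter_upwards [Lp.coeFn_sub f g] with x hx; rw [hx, Pi.sub_apply])
  rw [e, ← ENNReal.ofReal_le_ofReal_iff (by positivity), ofReal_integral_eq_lintegral_ofReal
    ((memLp_of_le hp (f - g)).integrable_norm_pow (by norm_num))
    (.of_forall fun x => by positivity)]
  refine le_trans (lintegral_mono fun x => ?_) h
  rw [ENNReal.ofReal_pow (norm_nonneg _), ofReal_norm, ENNReal.rpow_two]

theorem fieldCoeff_sub {d : ℕ} {f g : Torus d → Vec d} (hf : MemLp f 2 (torusMeasure d))
    (hg : MemLp g 2 (torusMeasure d)) (m : Fin d → ℤ) (i : Fin d) :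
    fieldCoeff (fun x => f x - g x) m i = fieldCoeff f m i - fieldCoeff g m i := by
  have h : ∀ {f : Torus d → Vec d}, MemLp f 2 (torusMeasure d) →
      Integrable (fun x => ((f x i : ℝ) : ℂ)) (torusMeasure d) := fun hf =>
    ((memLp_component hf i).integrable (by norm_num)).ofReal
  rw [fieldCoeff, fieldCoeff, fieldCoeff, ← mFourierCoeff_sub (h hf) (h hg)]
  simp

theorem sq_norm_fieldCoeff_le {d : ℕ} {w : Torus d → Vec d} (hw : MemLp w 2 (torusMeasure d))
    (m : Fin d → ℤ) (i : Fin d) :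
    ‖fieldCoeff w m i‖ ^ 2 ≤ ∫ x, ‖w x‖ ^ 2 ∂torusMeasure d := by
  refine (le_hasSum (hasSum_sq_norm_mFourierCoeff (memLp_component hw i).ofReal) m
    fun n _ => by positivity).trans ?_
  refine integral_mono ((memLp_component hw i).ofReal.integrable_norm_pow (by norm_num))
    (hw.integrable_norm_pow (by norm_num)) fun x => ?_
  simp only [RCLike.norm_ofReal]
  gcongr
  exact PiLp.norm_apply_le (w x) i

theorem continuousOn_of_sq_norm_sub_le {E F : Type*} [NormedAddCommGroup E]
    [NormedAddCommGroup F] {s : Set ℝ} {u : ℝ → E} {f : ℝ → F} (hu : ContinuousOn u s) {C : ℝ}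
    (h : ∀ x ∈ s, ∀ y ∈ s, ‖f x - f y‖ ^ 2 ≤ C * ‖u x - u y‖ ^ 2) : ContinuousOn f s := by
  intro x hx
  rw [ContinuousWithinAt, tendsto_iff_norm_sub_tendsto_zero]
  have h1 : Filter.Tendsto (fun y => Real.sqrt (C * ‖u y - u x‖ ^ 2)) (nhdsWithin x s)
      (nhds 0) := by
    have h2 := tendsto_iff_norm_sub_tendsto_zero.1 (hu x hx)
    simpa using ((h2.pow 2).const_mul C).sqrt
  refine squeeze_zero' (.of_forall fun y => norm_nonneg _) ?_ h1
  filter_upwards [self_mem_nhdsWithin] with y hy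
  exact Real.le_sqrt_of_sq_le (h y hy x hx)

theorem continuousOn_fieldCoeff {d : ℕ} {p : ℝ≥0∞} [Fact (1 ≤ p)] (hp : 2 ≤ p) {s : Set ℝ}
    {u : ℝ → LpField d p} (hu : ContinuousOn u s) (m : Fin d → ℤ) (i : Fin d) :
    ContinuousOn (fun t => fieldCoeff (fun x => u t x) m i) s := by
  refine continuousOn_of_sq_norm_sub_le hu (C := 1) fun x _ y _ => ?_
  rw [← fieldCoeff_sub (memLp_of_le hp _) (memLp_of_le hp _), one_mul]
  exact (sq_norm_fieldCoeff_le ((memLp_of_le hp (u x)).sub (memLp_of_le hp (u y))) m i).trans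
    (integral_sq_norm_sub_le hp _ _)

theorem continuousOn_tensorCoeff {d : ℕ} {p : ℝ≥0∞} [Fact (1 ≤ p)] (hp : 2 ≤ p) {s : Set ℝ}
    (hs : IsCompact s) {u : ℝ → LpField d p} (hu : ContinuousOn u s) (m : Fin d → ℤ)
    (k j : Fin d) : ContinuousOn (fun t => tensorCoeff (fun x => u t x) m k j) s := by
  obtain ⟨C, hC⟩ := hs.exists_bound_of_continuousOn hu
  have hp' : ENNReal.ofReal 2 ≤ p := by simpa using hp
  refine continuousOn_of_sq_norm_sub_le hu (C := 4 * C ^ 2) fun x hx y hy => ?_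
  have hM : ∀ t ∈ s, (∫⁻ x, ‖u t x‖ₑ ^ (2 : ℝ) ∂torusMeasure d) ^ (2 / 2 : ℝ) ≤
      ENNReal.ofReal (C ^ 2) := fun t ht =>
    (lintegral_rpow_le_norm_sq two_pos hp' (u t)).trans (ENNReal.ofReal_le_ofReal
      (pow_le_pow_left₀ (norm_nonneg _) (hC t ht) 2))
  -- The block estimate for the single frequency m with q = 2, where the cardinality factor is 1.
  have h := sum_sq_norm_tensorCoeff_sub_le (memLp_of_le hp (u x)) (memLp_of_le hp (u y)) le_rfl
    (sq_nonneg C) (hM x hx) (hM y hy) {m} k j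
  simp only [Finset.sum_singleton, Finset.card_singleton, Nat.cast_one, Real.one_rpow] at h
  have h2 := mul_le_mul_of_nonneg_right (integral_sq_norm_sub_le hp (u x) (u y)) (sq_nonneg C)
  linarith

theorem continuousOn_lerayDivCoeff {d : ℕ} {p : ℝ≥0∞} [Fact (1 ≤ p)] (hp : 2 ≤ p) {s : Set ℝ}
    (hs : IsCompact s) {u : ℝ → LpField d p} (hu : ContinuousOn u s) (m : Fin d → ℤ)
    (i : Fin d) : ContinuousOn (fun t => lerayDivCoeff (fun x => u t x) m i) s := by
  unfold lerayDivCoeff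
  refine continuousOn_finsetSum _ fun k _ => continuousOn_const.mul ?_
  exact continuousOn_finsetSum _ fun j _ => continuousOn_const.mul
    (continuousOn_tensorCoeff hp hs hu m k j)

/-! ### Duhamel's formula for each Fourier coefficient -/

/-- For a fixed mode the symbol is an exponential in time, meaningful for negative times too.
Pulling the t-dependence out of the Duhamel integral leaves a primitive, hence continuity in t. -/
theorem heatSymbol_sub {d : ℕ} (α t s : ℝ) (m : Fin d → ℤ) :
    heatSymbol α (t - s) m = heatSymbol α t m * heatSymbol α (-s) m := by
  rw [heatSymbol, heatSymbol, heatSymbol, ← Real.exp_add]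
  congr 1
  ring

theorem continuous_heatSymbol {d : ℕ} (α : ℝ) (m : Fin d → ℤ) :
    Continuous fun t => heatSymbol α t m := by
  unfold heatSymbol
  fun_prop

theorem continuousOn_bilinearCoeff {d : ℕ} {α T : ℝ} {u : ℝ → Torus d → Vec d} (hT : 0 ≤ T)
    {m : Fin d → ℤ} {i : Fin d}
    (hG : ContinuousOn (fun t => lerayDivCoeff (u t) m i) (Icc 0 T)) :
    ContinuousOn (fun t => bilinearCoeff α u t m i) (Icc 0 T) := by
  have h1 : ∀ t, bilinearCoeff α u t m i = (heatSymbol α t m : ℂ) *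
      ∫ s in (0 : ℝ)..t, (heatSymbol α (-s) m : ℂ) * lerayDivCoeff (u s) m i := fun t => by
    rw [bilinearCoeff, ← intervalIntegral.integral_const_mul]
    refine intervalIntegral.integral_congr fun s _ => ?_
    simp only [heatSymbol_sub]
    push_cast
    ring
  simp_rw [h1]
  have hc := continuous_heatSymbol α m
  refine (Complex.continuous_ofReal.comp hc).continuousOn.mul ?_
  rw [← uIcc_of_le hT] at hG ⊢
  refine intervalIntegral.continuousOn_primitive_interval ?_
  refine ContinuousOn.integrableOn_compact isCompact_uIcc (ContinuousOn.mul ?_ hG)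
  exact (Complex.continuous_ofReal.comp (hc.comp continuous_neg)).continuousOn

/-- For a solution continuous in time, the distributional Duhamel identity holds for every
Fourier coefficient at every time. -/
theorem IsMildSolution.fieldCoeff_eq {d : ℕ} {α T : ℝ} (hT : 0 < T) {p : ℝ≥0∞} [Fact (1 ≤ p)]
    (hp : 2 ≤ p) {u₀ : Torus d → Vec d} {u : ℝ → LpField d p} (hc : ContinuousOn u (Icc 0 T))
    (hu : IsMildSolution α T u₀ (fun t x => u t x)) (m : Fin d → ℤ) (i : Fin d) :
    ∀ t ∈ Icc 0 T, fieldCoeff (fun x => u t x) m i =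
      heatCoeff α u₀ t m i - bilinearCoeff α (fun t x => u t x) t m i := by
  have c1 := continuousOn_fieldCoeff hp hc m i
  have c2 : ContinuousOn (fun t => heatCoeff α u₀ t m i) (Icc 0 T) := by
    unfold heatCoeff
    exact ((Complex.continuous_ofReal.comp (continuous_heatSymbol α m)).mul
      continuous_const).continuousOn
  have c3 := continuousOn_bilinearCoeff (α := α) hT.le
    (continuousOn_lerayDivCoeff hp isCompact_Icc hc m i)
  suffices h : ∀ t ∈ Icc 0 T, fieldCoeff (fun x => u t x) m i - (heatCoeff α u₀ t m i -
      bilinearCoeff α (fun t x => u t x) t m i) = 0 from fun t ht => sub_eq_zero.1 (h t ht)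
  refine eq_zero_on_Icc_of_integral_smul_eq_zero hT (c1.sub (c2.sub c3)) fun χ h1 h2 h3 => ?_
  have hχ : ContinuousOn (fun t => (χ t : ℂ)) (Icc 0 T) :=
    (Complex.continuous_ofReal.comp h1.continuous).continuousOn
  -- The pairing has no complex conjugation, so the mode -m selects the coefficient at m.
  have key := hu _ (isTestFunction_smul_mFourier hT h1 h2 h3 (-m)) i
  simp_rw [pairing_smul_mFourier, integral_mul_smul_mFourier] at key
  have hi : ∀ {f : ℝ → ℂ}, ContinuousOn f (Icc 0 T) →
      IntervalIntegrable (fun t => (χ t : ℂ) * f t) volume 0 T := fun hf =>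
    ContinuousOn.intervalIntegrable (by rw [uIcc_of_le hT.le]; exact hχ.mul hf)
  simp_rw [mul_sub]
  rw [intervalIntegral.integral_sub (hi c1) ((hi c2).sub (hi c3)),
    intervalIntegral.integral_sub (hi c2) (hi c3), key, sub_self]

/-! ### Damped time integrals with exponential weight -/

/-- The weight adds K to the dissipation rate: the integrand is e^(-t lam) e^((lam + K) s), and the
lower endpoint contributes negatively. -/
theorem integral_exp_mul_exp_le {lam K t : ℝ} (hlam : 0 ≤ lam) (hK : 0 < K) :
    ∫ s in (0 : ℝ)..t, Real.exp (-(t - s) * lam) * Real.exp (K * s) ≤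
      Real.exp (K * t) / (lam + K) := by
  have hne : lam + K ≠ 0 := by positivity
  have h1 : ∀ s, Real.exp (-(t - s) * lam) * Real.exp (K * s) =
      Real.exp (-t * lam) * Real.exp ((lam + K) * s) := fun s => by
    rw [← Real.exp_add, ← Real.exp_add]
    congr 1
    ring
  simp_rw [h1]
  rw [intervalIntegral.integral_const_mul,
    intervalIntegral.integral_comp_mul_left (fun x => Real.exp x) hne, integral_exp, smul_eq_mul,
    mul_zero, Real.exp_zero]
  calc _ ≤ Real.exp (-t * lam) * ((lam + K)⁻¹ * Real.exp ((lam + K) * t)) := by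
        gcongr
        linarith
    _ = _ := by
        rw [mul_left_comm, ← Real.exp_add, div_eq_inv_mul]
        congr 2
        ring

/-- A finite family of Duhamel integrals, with exponentially damped kernels, in the `ℓ²` norm. -/
theorem sum_sq_norm_integral_le {ι : Type*} (A : Finset ι) {h : ι → ℝ → ℝ} {G : ι → ℝ → ℂ}
    {t lam K D : ℝ} (ht : 0 ≤ t) (hlam : 0 ≤ lam) (hK : 0 < K) (hD : 0 ≤ D)
    (hc : ∀ m, Continuous (h m)) (h0 : ∀ m ∈ A, ∀ s, 0 ≤ h m s)
    (hle : ∀ m ∈ A, ∀ s, 0 ≤ s → h m s ≤ Real.exp (-s * lam))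
    (hG : ∀ m, ContinuousOn (G m) (Icc 0 t))
    (hGD : ∀ s ∈ Icc 0 t, ∑ m ∈ A, ‖G m s‖ ^ 2 ≤ D * Real.exp (2 * K * s)) :
    ∑ m ∈ A, ‖∫ s in (0 : ℝ)..t, (h m (t - s) : ℂ) * G m s‖ ^ 2 ≤
      D * Real.exp (2 * K * t) / (lam + K) ^ 2 := by
  -- As one vector-valued integral, the family obeys Minkowski's inequality: the ℓ² norm of the
  -- integral is at most the integral of the ℓ² norms.
  set V : ℝ → EuclideanSpace ℂ A := fun s =>
    WithLp.toLp 2 fun m : A => (h m (t - s) : ℂ) * G m s with hV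
  have hVc : ContinuousOn V (Icc 0 t) := by
    refine (PiLp.continuous_toLp 2 _).comp_continuousOn (continuousOn_pi.2 fun m => ?_)
    refine ContinuousOn.mul (Continuous.continuousOn ?_) (hG m)
    exact Complex.continuous_ofReal.comp ((hc m).comp (by fun_prop))
  have hVi : IntervalIntegrable V volume 0 t :=
    ContinuousOn.intervalIntegrable (by rwa [uIcc_of_le ht])
  have hcomp : ∀ m : A, (∫ s in (0 : ℝ)..t, V s) m =
      ∫ s in (0 : ℝ)..t, (h m (t - s) : ℂ) * G m s := fun m =>
    ((EuclideanSpace.proj (𝕜 := ℂ) m).intervalIntegral_comp_comm hVi).symm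
  have hn : ‖∫ s in (0 : ℝ)..t, V s‖ ≤ Real.sqrt D * (Real.exp (K * t) / (lam + K)) := by
    refine (intervalIntegral.norm_integral_le_of_norm_le ht
      (g := fun s => Real.sqrt D * (Real.exp (-(t - s) * lam) * Real.exp (K * s)))
      (.of_forall fun s hs => ?_) (Continuous.intervalIntegrable (by fun_prop) _ _)).trans ?_
    · refine (sq_le_sq₀ (norm_nonneg _) (by positivity)).1 ?_
      rw [EuclideanSpace.norm_sq_eq, mul_pow, Real.sq_sqrt hD, mul_pow, ← Real.exp_nat_mul _ 2]
      calc ∑ m : A, ‖V s m‖ ^ 2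
          ≤ ∑ m : A, Real.exp (-(t - s) * lam) ^ 2 * ‖G m s‖ ^ 2 := by
            refine Finset.sum_le_sum fun m _ => ?_
            rw [hV, norm_mul, mul_pow, Complex.norm_real, Real.norm_of_nonneg (h0 m m.2 _)]
            gcongr
            · exact h0 m m.2 _
            · exact hle m m.2 _ (by linarith [hs.2])
        _ = Real.exp (-(t - s) * lam) ^ 2 * ∑ m ∈ A, ‖G m s‖ ^ 2 := by
            rw [← Finset.mul_sum, Finset.sum_coe_sort A fun m => ‖G m s‖ ^ 2]
        _ ≤ Real.exp (-(t - s) * lam) ^ 2 * (D * Real.exp (2 * K * s)) := by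
            gcongr
            exact hGD s ⟨hs.1.le, hs.2⟩
        _ = _ := by
            rw [← Real.exp_nat_mul (K * s) 2, ← Real.exp_nat_mul _ 2]
            push_cast
            ring_nf
    · rw [intervalIntegral.integral_const_mul]
      gcongr
      exact integral_exp_mul_exp_le hlam hK
  calc _ = ‖∫ s in (0 : ℝ)..t, V s‖ ^ 2 := by
        rw [EuclideanSpace.norm_sq_eq, ← Finset.sum_coe_sort A]
        simp_rw [hcomp]
    _ ≤ (Real.sqrt D * (Real.exp (K * t) / (lam + K))) ^ 2 := by gcongr
    _ = _ := by
        rw [mul_pow, Real.sq_sqrt hD, div_pow, ← Real.exp_nat_mul (K * t) 2]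
        push_cast
        ring_nf

/-! ### Dyadic blocks of frequencies -/

/-- The largest absolute value of an entry of a frequency. -/
def supFreq {d : ℕ} (m : Fin d → ℤ) : ℕ := Finset.univ.sup fun i => (m i).natAbs

theorem natAbs_le_supFreq {d : ℕ} (m : Fin d → ℤ) (i : Fin d) : (m i).natAbs ≤ supFreq m :=
  Finset.le_sup (f := fun i => (m i).natAbs) (Finset.mem_univ i)

theorem supFreq_ne_zero {d : ℕ} {m : Fin d → ℤ} (hm : m ≠ 0) : supFreq m ≠ 0 := by
  obtain ⟨i, hi⟩ := Function.ne_iff.1 hm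
  have := natAbs_le_supFreq m i
  have : (m i).natAbs ≠ 0 := Int.natAbs_ne_zero.2 hi
  omega

/-- Blocks are cut by the sup norm, for which lattice points are easily counted; this comparison
passes the lower bound to the Euclidean length in the heat symbol. -/
theorem supFreq_le_freqNorm {d : ℕ} (m : Fin d → ℤ) : (supFreq m : ℝ) ≤ freqNorm m := by
  refine Finset.sup_induction (p := fun n : ℕ => (n : ℝ) ≤ freqNorm m) ?_ ?_ ?_
  · rw [Nat.bot_eq_zero, Nat.cast_zero]
    exact Real.sqrt_nonneg _
  · intro a ha b hb
    rcases le_total a b with h | h <;> simp [h, ha, hb]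
  · intro i _
    rw [Nat.cast_natAbs, Int.cast_abs]
    exact abs_apply_le_freqNorm m i

theorem card_le_of_supFreq_lt {d j : ℕ} {A : Finset (Fin d → ℤ)}
    (hA : ∀ m ∈ A, supFreq m < 2 ^ (j + 1)) : A.card ≤ 2 ^ ((j + 3) * d) := by
  have h1 : A ⊆ Fintype.piFinset fun _ : Fin d => Finset.Icc (-(2 ^ (j + 1) : ℤ)) (2 ^ (j + 1)) := by
    intro m hm
    rw [Fintype.mem_piFinset]
    intro i
    have h2 := (natAbs_le_supFreq m i).trans_lt (hA m hm)
    have h3 : |m i| < 2 ^ (j + 1) := by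
      rw [Int.abs_eq_natAbs]
      exact_mod_cast h2
    rw [Finset.mem_Icc]
    exact ⟨(abs_lt.1 h3).1.le, (abs_lt.1 h3).2.le⟩
  refine (Finset.card_le_card h1).trans ?_
  rw [Fintype.card_piFinset, Finset.prod_const, Int.card_Icc, Finset.card_univ, Fintype.card_fin,
    pow_mul]
  refine Nat.pow_le_pow_left ?_ d
  -- Each side of the cube has 2 · 2^(j+1) + 1 ≤ 2^(j+3) integers.
  have h4 : (1 : ℤ) ≤ 2 ^ j := one_le_pow₀ (by norm_num)
  rw [Int.toNat_le]
  push_cast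
  rw [pow_succ, pow_add]
  linarith

/-- Summation over dyadic blocks of frequencies. -/
theorem sum_le_of_dyadic {d : ℕ} {a : (Fin d → ℤ) → ℝ} (h0 : a 0 = 0) {C ρ : ℝ} (hC : 0 ≤ C)
    (hρ0 : 0 ≤ ρ) (hρ1 : ρ < 1)
    (h : ∀ (j : ℕ) (A : Finset (Fin d → ℤ)),
      (∀ m ∈ A, 2 ^ j ≤ supFreq m ∧ supFreq m < 2 ^ (j + 1)) → ∑ m ∈ A, a m ≤ C * ρ ^ j)
    (B : Finset (Fin d → ℤ)) : ∑ m ∈ B, a m ≤ C * (1 - ρ)⁻¹ := by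
  classical
  -- Frequency 0 lies in no dyadic block, although `Nat.log 2 0 = 0` would file it under j = 0.
  rw [← Finset.sum_erase B h0]
  obtain ⟨J, hJ⟩ : ∃ J, ∀ m ∈ B.erase 0, Nat.log 2 (supFreq m) ∈ Finset.range J :=
    ⟨(B.erase 0).sup (fun m => Nat.log 2 (supFreq m)) + 1, fun m hm =>
      Finset.mem_range.2 (Nat.lt_succ_of_le
        (Finset.le_sup (f := fun m => Nat.log 2 (supFreq m)) hm))⟩
  rw [← Finset.sum_fiberwise_of_maps_to hJ]
  calc _ ≤ ∑ j ∈ Finset.range J, C * ρ ^ j := by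
        refine Finset.sum_le_sum fun j _ => h j _ fun m hm => ?_
        rw [Finset.mem_filter, Finset.mem_erase] at hm
        have hne := supFreq_ne_zero hm.1.1
        rw [← hm.2]
        exact ⟨Nat.pow_log_le_self 2 hne, Nat.lt_pow_succ_log_self (by norm_num) _⟩
    _ = C * ∑ j ∈ Finset.range J, ρ ^ j := (Finset.mul_sum _ _ _).symm
    _ ≤ _ := by
        gcongr
        rw [← tsum_geometric_of_lt_one hρ0 hρ1]
        exact (summable_geometric_of_lt_one hρ0 hρ1).sum_le_tsum _ fun j _ => by positivity

theorem rpow_mul_rpow_le_add {a b ε : ℝ} (ha : 0 ≤ a) (hb : 0 < b) (h0 : 0 ≤ ε) (h1 : ε ≤ 1) :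
    a ^ (1 - ε) * b ^ ε ≤ a + b := by
  calc a ^ (1 - ε) * b ^ ε ≤ (a + b) ^ (1 - ε) * (a + b) ^ ε := by
        gcongr <;> linarith
    _ = a + b := by
        rw [← Real.rpow_add (by linarith)]
        simp

/-- The dyadic balance of powers: the derivative and the `L^q` loss are absorbed by the
dissipation, and a positive power of `K` is left over. -/
theorem dyadic_power_le {α q K : ℝ} {d j n : ℕ} (hα : 1 / 2 < α) (hq : 0 < q)
    (hβ : (d : ℝ) / q < 2 * α - 1) (hK : 0 < K) (hn : n ≤ 2 ^ ((j + 3) * d)) :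
    (2 ^ (j + 1) : ℝ) ^ 2 * (n : ℝ) ^ (2 / q) / (((2 : ℝ) ^ j) ^ (2 * α) + K) ^ 2 ≤
      (2 : ℝ) ^ (2 + 6 * d / q) * ((2 : ℝ) ^ (-(2 * α - 1 - d / q))) ^ j *
        K ^ (-((2 * α - 1 - d / q) / (2 * α))) := by
  set β := 2 * α - 1 - d / q with hβ'
  -- The squared dissipation exceeds the losses by 2^(2βj). With 4αε = β, half of this surplus is
  -- traded for K^(2ε) = K^(β/(2α)), and 2^(-βj) remains for summation over j.
  set ε := β / (4 * α) with hε
  have hdq : 0 ≤ (d : ℝ) / q := by positivity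
  have hβ0 : 0 < β := by linarith
  have hε0 : 0 < ε := by positivity
  have hε1 : ε ≤ 1 := by
    rw [hε, div_le_one (by linarith)]
    linarith
  have hαε : 4 * α * ε = β := by
    rw [hε]
    field_simp
  have e1 : (2 ^ (j + 1) : ℝ) ^ 2 = (2 : ℝ) ^ (2 * ((j : ℝ) + 1)) := by
    rw [← pow_mul, ← Real.rpow_natCast]
    congr 1
    push_cast
    ring
  have e2 : (n : ℝ) ^ (2 / q) ≤ (2 : ℝ) ^ (((j : ℝ) + 3) * d * (2 / q)) := by
    rw [Real.rpow_mul two_pos.le]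
    gcongr
    calc (n : ℝ) ≤ ((2 ^ ((j + 3) * d) : ℕ) : ℝ) := by exact_mod_cast hn
      _ = _ := by
        push_cast
        rw [← Real.rpow_natCast]
        push_cast
        rfl
  have e3 : ((2 : ℝ) ^ j) ^ (2 * α) = (2 : ℝ) ^ (j * (2 * α)) := by
    rw [← Real.rpow_natCast, ← Real.rpow_mul two_pos.le]
  have e4 : (2 : ℝ) ^ (j * (4 * α - β)) * K ^ (β / (2 * α)) ≤
      (((2 : ℝ) ^ j) ^ (2 * α) + K) ^ 2 := by
    rw [e3]
    calc _ = (((2 : ℝ) ^ (j * (2 * α))) ^ (1 - ε) * K ^ ε) ^ 2 := by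
          rw [mul_pow, ← Real.rpow_mul two_pos.le, ← Real.rpow_mul_natCast two_pos.le,
            ← Real.rpow_mul_natCast hK.le, ← hαε]
          congr 2
          · push_cast
            ring
          · push_cast
            field_simp
            ring
      _ ≤ _ := by
          gcongr
          exact rpow_mul_rpow_le_add (by positivity) hK hε0.le hε1
  rw [div_le_iff₀ (by positivity)]
  calc _ ≤ (2 : ℝ) ^ (2 * ((j : ℝ) + 1)) * (2 : ℝ) ^ (((j : ℝ) + 3) * d * (2 / q)) := by
        rw [e1]
        gcongr
    _ = (2 : ℝ) ^ (2 + 6 * d / q) * ((2 : ℝ) ^ (-β)) ^ j * K ^ (-(β / (2 * α))) *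
        ((2 : ℝ) ^ (j * (4 * α - β)) * K ^ (β / (2 * α))) := by
        have : K ^ (-(β / (2 * α))) * K ^ (β / (2 * α)) = 1 := by
          rw [← Real.rpow_add hK]
          simp
        rw [← Real.rpow_mul_natCast two_pos.le, ← Real.rpow_add two_pos]
        calc _ = (2 : ℝ) ^ (2 + 6 * d / q) * (2 : ℝ) ^ (-β * j) * (2 : ℝ) ^ (j * (4 * α - β)) := by
              rw [← Real.rpow_add two_pos, ← Real.rpow_add two_pos, hβ']
              congr 1
              field_simp
              ring
          _ = _ := by
              rw [mul_mul_mul_comm, this, mul_one]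
    _ ≤ _ := by gcongr

/-! ### Contraction estimate and uniqueness -/

theorem heatSymbol_le {d : ℕ} {α t r : ℝ} (hα : 0 ≤ α) (ht : 0 ≤ t) {m : Fin d → ℤ} (hr : 0 ≤ r)
    (hm : r ≤ freqNorm m) : heatSymbol α t m ≤ Real.exp (-t * r ^ (2 * α)) := by
  rw [heatSymbol]
  refine Real.exp_le_exp.2 ?_
  rw [neg_mul, neg_mul, neg_le_neg_iff]
  gcongr
  nlinarith [Real.pi_gt_three]

/-- A divergence has mean zero; this disposes of the one frequency outside all dyadic blocks. -/
theorem lerayDivCoeff_zero {d : ℕ} (f : Torus d → Vec d) (i : Fin d) :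
    lerayDivCoeff f 0 i = 0 := by
  simp [lerayDivCoeff]

theorem fieldCoeff_sub_eq_integral {d : ℕ} {α T : ℝ} (hT : 0 < T) {p : ℝ≥0∞} [Fact (1 ≤ p)]
    (hp : 2 ≤ p) {u₀ : Torus d → Vec d} {u v : ℝ → LpField d p}
    (hu_cont : ContinuousOn u (Icc 0 T)) (hv_cont : ContinuousOn v (Icc 0 T))
    (hu : IsMildSolution α T u₀ (fun t x => u t x)) (hv : IsMildSolution α T u₀ (fun t x => v t x))
    (m : Fin d → ℤ) (i : Fin d) {t : ℝ} (ht : t ∈ Icc 0 T) :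
    fieldCoeff (fun x => u t x - v t x) m i = -∫ s in (0 : ℝ)..t, (heatSymbol α (t - s) m : ℂ) *
      (lerayDivCoeff (fun x => u s x) m i - lerayDivCoeff (fun x => v s x) m i) := by
  have hi : ∀ {w : ℝ → LpField d p}, ContinuousOn w (Icc 0 T) → IntervalIntegrable
      (fun s => (heatSymbol α (t - s) m : ℂ) * lerayDivCoeff (fun x => w s x) m i)
      volume 0 t := fun hw => by
    refine ContinuousOn.intervalIntegrable ?_
    rw [uIcc_of_le ht.1]
    refine ContinuousOn.mul (Continuous.continuousOn ?_) (continuousOn_lerayDivCoeff hp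
      isCompact_Icc (hw.mono (Icc_subset_Icc_right ht.2)) m i)
    exact Complex.continuous_ofReal.comp ((continuous_heatSymbol α m).comp (by fun_prop))
  rw [fieldCoeff_sub (memLp_of_le hp _) (memLp_of_le hp _), hu.fieldCoeff_eq hT hp hu_cont m i t ht,
    hv.fieldCoeff_eq hT hp hv_cont m i t ht, bilinearCoeff, bilinearCoeff]
  simp_rw [mul_sub]
  rw [intervalIntegral.integral_sub (hi hu_cont) (hi hv_cont)]
  ring

/-- One step of the fixed point argument, in `L²` with the weight `exp (2 K t)` in time. -/
theorem exists_integral_sq_norm_sub_le {d : ℕ} {α T : ℝ} (hT : 0 < T) (hα : 1 / 2 < α) {p : ℝ≥0∞}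
    [Fact (1 ≤ p)] {q : ℝ} (hq : 2 ≤ q) (hqp : ENNReal.ofReal q ≤ p)
    (hβ : (d : ℝ) / q < 2 * α - 1) {u₀ : Torus d → Vec d} {u v : ℝ → LpField d p}
    (hu_cont : ContinuousOn u (Icc 0 T)) (hv_cont : ContinuousOn v (Icc 0 T))
    (hu : IsMildSolution α T u₀ (fun t x => u t x))
    (hv : IsMildSolution α T u₀ (fun t x => v t x)) :
    ∃ C : ℝ, ∀ K > 0, ∀ W ≥ 0,
      (∀ s ∈ Icc 0 T, ∫ x, ‖u s x - v s x‖ ^ 2 ∂torusMeasure d ≤ W * Real.exp (2 * K * s)) →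
      ∀ t ∈ Icc 0 T, ∫ x, ‖u t x - v t x‖ ^ 2 ∂torusMeasure d ≤
        C * K ^ (-((2 * α - 1 - d / q) / (2 * α))) * W * Real.exp (2 * K * t) := by
  have hq0 : 0 < q := by linarith
  have hp : 2 ≤ p := by
    refine le_trans ?_ hqp
    rw [← ENNReal.ofReal_ofNat 2]
    exact ENNReal.ofReal_le_ofReal hq
  obtain ⟨Mu, hMu⟩ := isCompact_Icc.exists_bound_of_continuousOn hu_cont
  obtain ⟨Mv, hMv⟩ := isCompact_Icc.exists_bound_of_continuousOn hv_cont
  set M : ℝ := Mu ^ 2 + Mv ^ 2 with hM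
  have hM0 : 0 ≤ M := by positivity
  have huM : ∀ s ∈ Icc 0 T, (∫⁻ x, ‖u s x‖ₑ ^ q ∂torusMeasure d) ^ (2 / q) ≤
      ENNReal.ofReal M := fun s hs =>
    (lintegral_rpow_le_norm_sq hq0 hqp (u s)).trans (ENNReal.ofReal_le_ofReal (by
      have := pow_le_pow_left₀ (norm_nonneg _) (hMu s hs) 2
      nlinarith))
  have hvM : ∀ s ∈ Icc 0 T, (∫⁻ x, ‖v s x‖ₑ ^ q ∂torusMeasure d) ^ (2 / q) ≤
      ENNReal.ofReal M := fun s hs =>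
    (lintegral_rpow_le_norm_sq hq0 hqp (v s)).trans (ENNReal.ofReal_le_ofReal (by
      have := pow_le_pow_left₀ (norm_nonneg _) (hMv s hs) 2
      nlinarith))
  set ρ : ℝ := (2 : ℝ) ^ (-(2 * α - 1 - d / q)) with hρ
  have hρ0 : 0 ≤ ρ := by positivity
  have hρ1 : ρ < 1 := Real.rpow_lt_one_of_one_lt_of_neg one_lt_two (by linarith)
  set C₀ : ℝ := 64 * Real.pi ^ 2 * (d : ℝ) ^ 4 * M with hC₀
  have hC₀0 : 0 ≤ C₀ := by positivity
  refine ⟨d * (C₀ * (2 : ℝ) ^ (2 + 6 * d / q) * (1 - ρ)⁻¹), fun K hK W hW hN t ht => ?_⟩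
  have hsub : Icc 0 t ⊆ Icc 0 T := Icc_subset_Icc_right ht.2
  have h := integral_sq_norm_le_of_fieldCoeff (w := fun x => u t x - v t x)
    ((memLp_of_le hp (u t)).sub (memLp_of_le hp (v t)))
    (D := C₀ * W * Real.exp (2 * K * t) * ((2 : ℝ) ^ (2 + 6 * d / q) *
      K ^ (-((2 * α - 1 - d / q) / (2 * α)))) * (1 - ρ)⁻¹) fun B i => ?_
  · refine h.trans (le_of_eq ?_)
    ring
  refine sum_le_of_dyadic (a := fun m => ‖fieldCoeff (fun x => u t x - v t x) m i‖ ^ 2) ?_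
    (by positivity) hρ0 hρ1 (fun j A hA => ?_) B
  · rw [fieldCoeff_sub_eq_integral hT hp hu_cont hv_cont hu hv 0 i ht]
    simp [lerayDivCoeff_zero]
  · simp_rw [fieldCoeff_sub_eq_integral hT hp hu_cont hv_cont hu hv _ i ht, norm_neg]
    have hcard := card_le_of_supFreq_lt fun m hm => (hA m hm).2
    have hR : ∀ m ∈ A, ∀ k, |(m k : ℝ)| ≤ 2 ^ (j + 1) := fun m hm k => by
      have h1 := (natAbs_le_supFreq m k).trans (hA m hm).2.le
      rw [← Int.cast_abs, Int.abs_eq_natAbs]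
      exact_mod_cast h1
    refine (sum_sq_norm_integral_le A (h := fun m s => heatSymbol α s m)
      (G := fun m s => lerayDivCoeff (fun x => u s x) m i - lerayDivCoeff (fun x => v s x) m i)
      (lam := ((2 : ℝ) ^ j) ^ (2 * α))
      (D := C₀ * (2 ^ (j + 1)) ^ 2 * (A.card : ℝ) ^ (2 / q) * W) ht.1 (by positivity) hK
      (by positivity) (continuous_heatSymbol α) (fun m _ s => (Real.exp_pos _).le)
      (fun m hm s hs => heatSymbol_le (by linarith) hs (by positivity) ?_) (fun m => ?_)
      fun s hs => ?_).trans ?_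
    · refine le_trans ?_ (supFreq_le_freqNorm m)
      exact_mod_cast (hA m hm).1
    · exact (continuousOn_lerayDivCoeff hp isCompact_Icc (hu_cont.mono hsub) m i).sub
        (continuousOn_lerayDivCoeff hp isCompact_Icc (hv_cont.mono hsub) m i)
    · refine (sum_sq_norm_lerayDivCoeff_sub_le (memLp_of_le hp (u s)) (memLp_of_le hp (v s)) hq hM0
        (huM s (hsub hs)) (hvM s (hsub hs)) A hR i).trans ?_
      rw [mul_assoc _ W]
      exact mul_le_mul_of_nonneg_left (hN s (hsub hs)) (by positivity)
    · have hpow := mul_le_mul_of_nonneg_left (dyadic_power_le hα hq0 hβ hK hcard)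
        (show 0 ≤ C₀ * W * Real.exp (2 * K * t) by positivity)
      refine (le_of_eq ?_).trans (hpow.trans (le_of_eq ?_))
      · ring
      · rw [hρ]
        ring

/-- The weighted estimate applies to any admissible W, so starting from the uniform bound on u - v
and fixing K with factor at most 1/2, each application halves W. No smallness of T is needed. -/
theorem eq_of_isMildSolution {d : ℕ} {α T : ℝ} (hT : 0 < T) (hα : 1 / 2 < α) {p : ℝ≥0∞}
    [Fact (1 ≤ p)] {q : ℝ} (hq : 2 ≤ q) (hqp : ENNReal.ofReal q ≤ p)
    (hβ : (d : ℝ) / q < 2 * α - 1) {u₀ : Torus d → Vec d} {u v : ℝ → LpField d p}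
    (hu_cont : ContinuousOn u (Icc 0 T)) (hv_cont : ContinuousOn v (Icc 0 T))
    (hu : IsMildSolution α T u₀ (fun t x => u t x))
    (hv : IsMildSolution α T u₀ (fun t x => v t x)) :
    ∀ t ∈ Icc 0 T, u t = v t := by
  have hp : 2 ≤ p := by
    refine le_trans ?_ hqp
    rw [← ENNReal.ofReal_ofNat 2]
    exact ENNReal.ofReal_le_ofReal hq
  obtain ⟨C, hC⟩ := exists_integral_sq_norm_sub_le hT hα hq hqp hβ hu_cont hv_cont hu hv
  obtain ⟨K, hK, hCK⟩ : ∃ K > 0, C * K ^ (-((2 * α - 1 - d / q) / (2 * α))) ≤ 1 / 2 := by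
    have hβ' : 0 < (2 * α - 1 - d / q) / (2 * α) := div_pos (by linarith) (by linarith)
    have hlim := (tendsto_rpow_neg_atTop hβ').const_mul C
    rw [mul_zero] at hlim
    obtain ⟨K, h1, h2⟩ := ((hlim.eventually (ge_mem_nhds (show (0 : ℝ) < 1 / 2 by norm_num))).and
      (Filter.eventually_gt_atTop 0)).exists
    exact ⟨K, h2, h1⟩
  obtain ⟨M, hM⟩ := isCompact_Icc.exists_bound_of_continuousOn (hu_cont.sub hv_cont)
  have hiter : ∀ n : ℕ, ∀ s ∈ Icc 0 T, ∫ x, ‖u s x - v s x‖ ^ 2 ∂torusMeasure d ≤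
      M ^ 2 * (1 / 2) ^ n * Real.exp (2 * K * s) := by
    intro n
    induction n with
    | zero =>
      intro s hs
      refine (integral_sq_norm_sub_le hp (u s) (v s)).trans ?_
      have h1 : ‖u s - v s‖ ^ 2 ≤ M ^ 2 := pow_le_pow_left₀ (norm_nonneg _) (hM s hs) 2
      have h2 : 1 ≤ Real.exp (2 * K * s) := Real.one_le_exp (mul_nonneg (by linarith) hs.1)
      rw [pow_zero, mul_one]
      nlinarith [sq_nonneg M]
    | succ n ih =>
      intro s hs
      refine (hC K hK _ (by positivity) ih s hs).trans ?_
      calc _ ≤ 1 / 2 * (M ^ 2 * (1 / 2) ^ n) * Real.exp (2 * K * s) := by gcongr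
        _ = _ := by ring
  intro t ht
  have hw : MemLp (fun x => u t x - v t x) 2 (torusMeasure d) :=
    (memLp_of_le hp (u t)).sub (memLp_of_le hp (v t))
  have hzero : ∫ x, ‖u t x - v t x‖ ^ 2 ∂torusMeasure d = 0 := by
    refine le_antisymm ?_ (integral_nonneg fun x => by positivity)
    have hlim : Filter.Tendsto (fun n : ℕ => M ^ 2 * (1 / 2 : ℝ) ^ n * Real.exp (2 * K * t))
        Filter.atTop (nhds 0) := by
      simpa using ((tendsto_pow_atTop_nhds_zero_of_lt_one (r := (1 / 2 : ℝ)) (by norm_num)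
        (by norm_num)).const_mul (M ^ 2)).mul_const (Real.exp (2 * K * t))
    exact ge_of_tendsto' hlim fun n => hiter n t ht
  rw [integral_eq_zero_iff_of_nonneg (fun x => by positivity)
    (hw.integrable_norm_pow (by norm_num))] at hzero
  refine Lp.ext ?_
  filter_upwards [hzero] with x hx
  simpa [sub_eq_zero] using hx

/-- The hypotheses on `p` provide a finite exponent `q ≤ p` which is still subcritical. -/
theorem exists_subcritical_exponent {d : ℕ} (hd : 2 ≤ d) {α : ℝ} (hα : 1 / 2 < α) {p : ℝ≥0∞}
    (hp_low : α ≤ ((d : ℝ) + 2) / 4 → ENNReal.ofReal ((d : ℝ) / (2 * α - 1)) < p)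
    (hp_high : ((d : ℝ) + 2) / 4 < α → 2 ≤ p) :
    ∃ q : ℝ, 2 ≤ q ∧ ENNReal.ofReal q ≤ p ∧ (d : ℝ) / q < 2 * α - 1 := by
  have ha : 0 < 2 * α - 1 := by linarith
  have hd0 : (0 : ℝ) < d := by exact_mod_cast (by omega : 0 < d)
  rcases le_or_gt α (((d : ℝ) + 2) / 4) with h | h
  · obtain ⟨q, hq1, hq2⟩ := ENNReal.lt_iff_exists_nnreal_btwn.1 (hp_low h)
    have hq : (d : ℝ) / (2 * α - 1) < q := by
      rw [← ENNReal.ofReal_coe_nnreal] at hq1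
      exact (ENNReal.ofReal_lt_ofReal_iff_of_nonneg (by positivity)).1 hq1
    -- This is α ≤ (d + 2)/4 rewritten, so every q above the critical exponent exceeds 2.
    have h2 : 2 ≤ (d : ℝ) / (2 * α - 1) := by
      rw [le_div_iff₀ ha]
      linarith
    refine ⟨q, by linarith, ?_, ?_⟩
    · rw [ENNReal.ofReal_coe_nnreal]
      exact hq2.le
    · rw [div_lt_iff₀ (by linarith)]
      rw [div_lt_iff₀ ha] at hq
      linarith
  -- Here α > (d + 2)/4 says precisely d/2 < 2α - 1, so q = 2 is already subcritical.
  · refine ⟨2, le_rfl, by simpa using hp_high h, ?_⟩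
    linarith

end FracNS

theorem corollary2p4 (d : ℕ) (hd : 2 ≤ d) (α : ℝ) (hα : 1 / 2 < α)
    (p : ℝ≥0∞) [Fact (1 ≤ p)]
    (hp_low : α ≤ ((d : ℝ) + 2) / 4 → ENNReal.ofReal ((d : ℝ) / (2 * α - 1)) < p)
    (hp_high : ((d : ℝ) + 2) / 4 < α → 2 ≤ p)
    (u₀ : FracNS.LpField d p)
    (hu₀ : FracNS.IsDivFree (fun x => u₀ x))
    (T : ℝ) (hT : 0 < T)
    (u v : ℝ → FracNS.LpField d p)
    (hu_cont : ContinuousOn u (Icc 0 T)) (hv_cont : ContinuousOn v (Icc 0 T))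
    (hu : FracNS.IsMildSolution α T (fun x => u₀ x) (fun t x => u t x))
    (hv : FracNS.IsMildSolution α T (fun x => u₀ x) (fun t x => v t x)) :
    ∀ t ∈ Icc 0 T, u t = v t := by
  obtain ⟨q, hq, hqp, hβ⟩ := FracNS.exists_subcritical_exponent hd hα hp_low hp_high
  exact FracNS.eq_of_isMildSolution hT hα hq hqp hβ hu_cont hv_cont hu hv
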